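/- Consider the standard asynchronous shared-memory model in which $n$ deterministic processes, each with an input in $\{0,1\}$, communicate through a finite set $\mathcal A$ of shared readable swap objects. A readable swap object with domain size $b$ stores a value in $\{0,\dots,b-1\}$ and supports the atomic operations $\mathrm{Read}$, which returns its current value, and $\mathrm{Swap}(x)$ for $x\in\{0,\dots,b-1\}$, which sets its value to $x$ and returns its previous value. The initial values of the objects are fixed by the algorithm, and the initial state of a process depends only on the process and its input. The state of a process determines either the value that it has decided (in which case it takes no further steps) or the next operation that it will apply and the object to which it will apply it. In one step, a process applies this operation and then updates its state as a function of its state and the response. Local state sets may be infinite. A configuration consists of a state for every process and a value for every object; it is reachable if some finite execution, in which processes take steps in an arbitrary order, leads to it from an initial configuration. Such an algorithm is an obstruction-free binary consensus algorithm if it satisfies: - Agreement: in every execution from an initial configuration, all decided values are equal. - Validity: in every execution from an initial configuration, every decided value is the input of some process. - Obstruction-freedom: for every reachable configuration $C$ and every process $p$, there is a finite execution from $C$ that contains only steps by $p$ and ends in a configuration in which $p$ has decided. Theorem. For all integers $n, b \ge 2$, every $n$-process obstruction-free binary consensus algorithm from readable swap objects with domain size $b$ uses at least $\frac{n-2}{3b+1}$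 objects; that is, $|\mathcal A| \ge \frac{n-2}{3b+1}$. -/

import Mathlib

/-- The operations supported by a readable swap object whose domain is `{0, …, b - 1}`. -/
inductive SwapOp (b : ℕ) : Type
  | read : SwapOp b
  | swap (x : Fin b) : SwapOp b

/-- The value of a readable swap object after an operation is applied to it when its value is `v`.
Both operations return the value `v` that the object had before the operation. -/
def SwapOp.newValue {b : ℕ} (v : Fin b) : SwapOp b → Fin b
  | .read => v
  | .swap x => x

/-- What the state of a process says about it: either it has decided an output value, or it is
poised to apply a particular operation to a particular object. -/
inductive ProcStatus (b : ℕ) (Obj : Type*) : Type _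
  | decided (v : Fin 2) : ProcStatus b Obj
  | poised (B : Obj) (op : SwapOp b) : ProcStatus b Obj

universe u v

/-- A deterministic algorithm for `n` processes with binary inputs and outputs, whose shared objects
are readable swap objects, indexed by `Obj`, each with domain `{0, …, b - 1}`. -/
structure SwapAlgorithm (n b : ℕ) (Obj : Type u) where
  /-- the (possibly infinite) set of local states of processes -/
  State : Type v
  /-- the initial values of the objects -/
  initValue : Obj → Fin b
  /-- the initial state of a process, given its input -/
  initState : Fin n → Fin 2 → State
  /-- the decision of a process, or its next operation, in each of its states -/
  status : Fin n → State → ProcStatus b Obj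
  /-- the state of a process after its next operation, given the response to that operation -/
  update : Fin n → State → Fin b → State

namespace SwapAlgorithm

variable {n b : ℕ} {Obj : Type u} (A : SwapAlgorithm.{u, v} n b Obj)

/-- A configuration consists of a state for every process and a value for every object. -/
@[ext]
structure Config where
  state : Fin n → A.State
  value : Obj → Fin b

/-- The initial configuration in which process `p` has input `inp p`. -/
def initConfig (inp : Fin n → Fin 2) : A.Config where
  state := fun p => A.initState p (inp p)
  value := A.initValue

/-- Process `p` has decided `x` in the configuration `C`. -/
def Decided (C : A.Config) (p : Fin n) (x : Fin 2) : Prop :=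
  A.status p (C.state p) = .decided x

open Classical in
/-- The configuration that results when process `p`, poised to apply `op` to the object `B`, takes
its next step in `C`. -/
noncomputable def applyOp (C : A.Config) (p : Fin n) (B : Obj) (op : SwapOp b) : A.Config where
  state := Function.update C.state p (A.update p (C.state p) (C.value B))
  value := Function.update C.value B (op.newValue (C.value B))

/-- `A.Step p C C'`: process `p` has not decided in `C`, and its next step leads from `C` to `C'`. -/
def Step (p : Fin n) (C C' : A.Config) : Prop :=
  ∃ (B : Obj) (op : SwapOp b), A.status p (C.state p) = .poised B op ∧ C' = A.applyOp C p B op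

/-- `A.Exec P C C'`: there is a finite execution from `C` to `C'` in which every step is taken by a
process in `P`. -/
def Exec (P : Set (Fin n)) (C C' : A.Config) : Prop :=
  Relation.ReflTransGen (fun D D' => ∃ p ∈ P, A.Step p D D') C C'

/-- `C` is reached by some execution from the initial configuration with inputs `inp`. -/
def ReachableWith (inp : Fin n → Fin 2) (C : A.Config) : Prop :=
  A.Exec Set.univ (A.initConfig inp) C

/-- Agreement: in every execution, no two different values are decided. (A process that has decided
takes no further steps, so all decisions of an execution are present in its last configuration.) -/
def Agreement : Prop :=
  ∀ (inp : Fin n → Fin 2) (C : A.Config), A.ReachableWith inp C →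
    ∀ (p q : Fin n) (x y : Fin 2), A.Decided C p x → A.Decided C q y → x = y

/-- Validity: every value decided is the input of some process. -/
def Validity : Prop :=
  ∀ (inp : Fin n → Fin 2) (C : A.Config), A.ReachableWith inp C →
    ∀ (p : Fin n) (x : Fin 2), A.Decided C p x → ∃ q : Fin n, inp q = x

/-- Solo termination: from every reachable configuration and for every process `p`, there is a
`p`-only execution that ends with a configuration in which `p` has decided. -/
def SoloTerminating : Prop :=
  ∀ (inp : Fin n → Fin 2) (C : A.Config), A.ReachableWith inp C →
    ∀ p : Fin n, ∃ (C' : A.Config) (x : Fin 2), A.Exec {p} C C' ∧ A.Decided C' p x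

/-- The (deterministic) algorithm `A` is an obstruction-free binary consensus algorithm. -/
structure IsObstructionFreeBinaryConsensus : Prop where
  agreement : A.Agreement
  validity : A.Validity
  soloTerminating : A.SoloTerminating

end SwapAlgorithm

/-! Two processes `q₀`, `q₁` with different inputs form a pair that can initially decide either
value, and nobody has decided in a reachable configuration where the pair is bivalent. Suppose that
more than `card Obj * (3 * b + 1)` other processes exist. An event is an object holding a value, or
one or two processes being poised to swap a value into an object; there are `3 * b * card Obj` of
them. Discarding a process whenever this loses an event leaves a set `X` of more than `card Obj`
processes and a bivalent `C` from which every event can recur without steps of any chosen process of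
`X` (`exists_saturated`).

The processes of `X` then run solo, one after another. As long as a run makes no further object
coverable, each of its steps can be imitated between bivalent configurations, so the runner cannot
decide. Hence each run makes a new object coverable (`exists_coverable_ssubset`), and `X` has at
most `card Obj` processes (`card_le`), a contradiction. -/

namespace SwapAlgorithm

/-! ### Executions and indistinguishability -/

section Executions

variable {n b : ℕ} {Obj : Type u} {A : SwapAlgorithm.{u, v} n b Obj}

theorem applyOp_state_self (C : A.Config) (p : Fin n) (B : Obj) (op : SwapOp b) :
    (A.applyOp C p B op).state p = A.update p (C.state p) (C.value B) := by
  simp [applyOp]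

theorem applyOp_state_of_ne (C : A.Config) {p q : Fin n} (h : q ≠ p) (B : Obj) (op : SwapOp b) :
    (A.applyOp C p B op).state q = C.state q := by
  simp [applyOp, h]

theorem applyOp_value_self (C : A.Config) (p : Fin n) (B : Obj) (op : SwapOp b) :
    (A.applyOp C p B op).value B = op.newValue (C.value B) := by
  simp [applyOp]

theorem applyOp_value_of_ne (C : A.Config) (p : Fin n) {B B' : Obj} (h : B' ≠ B) (op : SwapOp b) :
    (A.applyOp C p B op).value B' = C.value B' := by
  simp [applyOp, h]

theorem applyOp_read_value (C : A.Config) (p : Fin n) (B : Obj) :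
    (A.applyOp C p B .read).value = C.value := by
  simp [applyOp, SwapOp.newValue]

/-- The objects have the same values after two operations that start from the same values, apart
from that of the object operated on, and that leave the same value in this object. -/
theorem applyOp_value_congr {C D : A.Config} {B : Obj} (h : ∀ B' ≠ B, C.value B' = D.value B')
    {p q : Fin n} {op op' : SwapOp b} (h' : op.newValue (C.value B) = op'.newValue (D.value B)) :
    (A.applyOp C p B op).value = (A.applyOp D q B op').value := by
  funext B'
  by_cases hB : B' = B
  · subst hB
    rw [applyOp_value_self, applyOp_value_self, h']
  · rw [applyOp_value_of_ne _ _ hB, applyOp_value_of_ne _ _ hB, h B' hB]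

theorem applyOp_comm (C : A.Config) {p q : Fin n} (hpq : p ≠ q) {B B' : Obj} (hB : B ≠ B')
    (op op' : SwapOp b) :
    A.applyOp (A.applyOp C p B op) q B' op' = A.applyOp (A.applyOp C q B' op') p B op := by
  classical
  ext1
  · funext r
    by_cases hp : r = p
    · subst hp
      rw [applyOp_state_of_ne _ hpq, applyOp_state_self, applyOp_state_self,
        applyOp_state_of_ne _ hpq, applyOp_value_of_ne _ _ hB]
    · by_cases hq : r = q
      · subst hq
        rw [applyOp_state_of_ne _ hp, applyOp_state_self, applyOp_state_self,
          applyOp_state_of_ne _ hp, applyOp_value_of_ne _ _ hB.symm]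
      · rw [applyOp_state_of_ne _ hq, applyOp_state_of_ne _ hp, applyOp_state_of_ne _ hp,
          applyOp_state_of_ne _ hq]
  · funext B''
    by_cases h : B'' = B
    · subst h
      rw [applyOp_value_of_ne _ _ hB, applyOp_value_self, applyOp_value_self,
        applyOp_value_of_ne _ _ hB]
    · by_cases h' : B'' = B'
      · subst h'
        rw [applyOp_value_of_ne _ _ h, applyOp_value_self, applyOp_value_self,
          applyOp_value_of_ne _ _ h]
      · rw [applyOp_value_of_ne _ _ h', applyOp_value_of_ne _ _ h, applyOp_value_of_ne _ _ h,
          applyOp_value_of_ne _ _ h']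

theorem Exec.refl (P : Set (Fin n)) (C : A.Config) : A.Exec P C C := Relation.ReflTransGen.refl

theorem Exec.trans {P : Set (Fin n)} {C D E : A.Config} (h : A.Exec P C D) (h' : A.Exec P D E) :
    A.Exec P C E := Relation.ReflTransGen.trans h h'

theorem Exec.mono {P P' : Set (Fin n)} (hP : P ⊆ P') {C D : A.Config} (h : A.Exec P C D) :
    A.Exec P' C D :=
  Relation.ReflTransGen.mono (fun _ _ ⟨p, hp, hs⟩ => ⟨p, hP hp, hs⟩) _ _ h

theorem Exec.of_poised {P : Set (Fin n)} {C : A.Config} {p : Fin n} (hp : p ∈ P) {B : Obj}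
    {op : SwapOp b} (h : A.status p (C.state p) = .poised B op) :
    A.Exec P C (A.applyOp C p B op) :=
  Relation.ReflTransGen.single ⟨p, hp, B, op, h, rfl⟩

theorem Exec.state_eq {P : Set (Fin n)} {C D : A.Config} (h : A.Exec P C D) {p : Fin n}
    (hp : p ∉ P) : D.state p = C.state p := by
  induction h with
  | refl => rfl
  | tail _ hs ih =>
    obtain ⟨q, hq, B, op, -, rfl⟩ := hs
    rw [applyOp_state_of_ne _ (by rintro rfl; exact hp hq), ih]

theorem Exec.decided {P : Set (Fin n)} {C D : A.Config} (h : A.Exec P C D) {p : Fin n}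
    {x : Fin 2} (hC : A.Decided C p x) : A.Decided D p x := by
  induction h with
  | refl => exact hC
  | tail _ hs ih =>
    obtain ⟨q, hq, B, op, hq', rfl⟩ := hs
    have : p ≠ q := by
      rintro rfl
      rw [Decided, hq'] at ih
      cases ih
    rw [Decided, applyOp_state_of_ne _ this]
    exact ih

theorem ReachableWith.exec {inp : Fin n → Fin 2} {C D : A.Config} (hC : A.ReachableWith inp C)
    {P : Set (Fin n)} (h : A.Exec P C D) : A.ReachableWith inp D :=
  Exec.trans hC (h.mono (Set.subset_univ P))

/-- The processes in `P` cannot distinguish `C` from `D`, and all objects have the same values. -/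
def Indist (P : Set (Fin n)) (C D : A.Config) : Prop :=
  (∀ p ∈ P, C.state p = D.state p) ∧ C.value = D.value

theorem Indist.exec {P : Set (Fin n)} {C D C' : A.Config} (h : Indist P C D)
    (hC : A.Exec P C C') : ∃ D', A.Exec P D D' ∧ Indist P C' D' := by
  induction hC with
  | refl => exact ⟨D, Exec.refl _ _, h⟩
  | @tail E F _ hs ih =>
    obtain ⟨D', hD', hst, hval⟩ := ih
    obtain ⟨q, hq, B, op, hq', rfl⟩ := hs
    rw [hst q hq] at hq'
    refine ⟨_, hD'.trans (Exec.of_poised hq hq'), fun p hp => ?_,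
      applyOp_value_congr (fun _ _ => by rw [hval]) (by rw [hval])⟩
    by_cases hpq : p = q
    · subst hpq
      rw [applyOp_state_self, applyOp_state_self, hst p hp, hval]
    · rw [applyOp_state_of_ne _ hpq, applyOp_state_of_ne _ hpq, hst p hp]

end Executions

/-! ### Bivalence of a pair, and its survival under a swap -/

section Valency

variable {n b : ℕ} {Obj : Type u} {A : SwapAlgorithm.{u, v} n b Obj}

/-- Some execution from `C` by processes in `P` ends with a process in `P` having decided `x`. -/
def CanDecide (P : Set (Fin n)) (C : A.Config) (x : Fin 2) : Prop :=
  ∃ D, A.Exec P C D ∧ ∃ p ∈ P, A.Decided D p x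

/-- Both values can be decided in executions from `C` by processes in `P`. -/
def Bivalent (P : Set (Fin n)) (C : A.Config) : Prop :=
  ∀ x, CanDecide P C x

theorem CanDecide.of_exec {P : Set (Fin n)} {C D : A.Config} (h : A.Exec P C D) {x : Fin 2}
    (hD : CanDecide P D x) : CanDecide P C x :=
  let ⟨E, hE, hp⟩ := hD
  ⟨E, h.trans hE, hp⟩

theorem CanDecide.mono {P P' : Set (Fin n)} (hP : P ⊆ P') {C : A.Config} {x : Fin 2}
    (hC : CanDecide P C x) : CanDecide P' C x :=
  let ⟨D, hD, p, hp, hx⟩ := hC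
  ⟨D, hD.mono hP, p, hP hp, hx⟩

theorem CanDecide.congr {P : Set (Fin n)} {C D : A.Config} (h : Indist P C D) {x : Fin 2}
    (hC : CanDecide P C x) : CanDecide P D x := by
  obtain ⟨C', hC', p, hp, hx⟩ := hC
  obtain ⟨D', hD', hI⟩ := h.exec hC'
  refine ⟨D', hD', p, hp, ?_⟩
  rw [Decided, ← hI.1 p hp]
  exact hx

theorem Bivalent.congr {P : Set (Fin n)} {C D : A.Config} (h : Indist P C D)
    (hC : Bivalent P C) : Bivalent P D :=
  fun x => (hC x).congr h

/-- No process has decided in a reachable bivalent configuration. -/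
theorem Bivalent.exists_poised (hA : A.Agreement) {inp : Fin n → Fin 2} {C : A.Config}
    (hC : A.ReachableWith inp C) {P : Set (Fin n)} (hbiv : Bivalent P C) (p : Fin n) :
    ∃ B op, A.status p (C.state p) = .poised B op := by
  cases h : A.status p (C.state p) with
  | poised B op => exact ⟨B, op, rfl⟩
  | decided x =>
    have hx : A.Decided C p x := h
    obtain ⟨D, hD, q, -, hq⟩ := hbiv (1 - x)
    exact absurd (hA inp D (hC.exec hD) p q x (1 - x) (hD.decided hx) hq)
      (by clear * -; revert x; decide)

theorem exists_canDecide (hA : A.SoloTerminating) {inp : Fin n → Fin 2} {C : A.Config}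
    (hC : A.ReachableWith inp C) (p : Fin n) : ∃ x, CanDecide {p} C x :=
  let ⟨D, x, hD, hx⟩ := hA inp C hC p
  ⟨x, D, hD, p, rfl, hx⟩

/-- A process decides its own input in a solo execution from an initial configuration. -/
theorem canDecide_initConfig (hA : A.IsObstructionFreeBinaryConsensus) (inp : Fin n → Fin 2)
    (p : Fin n) : CanDecide {p} (A.initConfig inp) (inp p) := by
  have hI : Indist {p} (A.initConfig fun _ => inp p) (A.initConfig inp) := by
    refine ⟨fun q hq => ?_, rfl⟩
    obtain rfl : q = p := hq
    rfl
  obtain ⟨C, x, hC, hx⟩ := hA.soloTerminating (fun _ => inp p) _ (Exec.refl _ _) p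
  obtain ⟨q, hq⟩ := hA.validity _ C (ReachableWith.exec (Exec.refl _ _) hC) p x hx
  subst hq
  exact CanDecide.congr hI ⟨C, hC, p, rfl, hx⟩

/-- If `p` is about to swap in a bivalent configuration, then the pair of processes can move to
a configuration that the step of `p` leaves bivalent. -/
theorem Bivalent.exists_applyOp (hA : A.SoloTerminating) {inp : Fin n → Fin 2} {q₀ q₁ : Fin n}
    (hq : q₀ ≠ q₁) {C : A.Config} (hC : A.ReachableWith inp C) (hbiv : Bivalent {q₀, q₁} C)
    {p : Fin n} (hp : p ∉ ({q₀, q₁} : Set (Fin n))) {B : Obj} {x : Fin b}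
    (hpB : A.status p (C.state p) = .poised B (.swap x)) :
    ∃ D, A.Exec {q₀, q₁} C D ∧ Bivalent {q₀, q₁} (A.applyOp D p B (.swap x)) := by
  set Q : Set (Fin n) := {q₀, q₁} with hQ
  by_contra! hcon
  have hreach : ∀ D, A.Exec Q C D → A.ReachableWith inp (A.applyOp D p B (.swap x)) :=
    fun D hD => (hC.exec hD).exec
      (Exec.of_poised (P := Set.univ) trivial (by rwa [hD.state_eq hp]))
  -- Follow a `Q`-execution to a decision of `y`. If `y` is impossible after `p`'s swap at the
  -- start, it stays impossible after `p`'s swap at every later point, including the end, where `y`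
  -- is already decided.
  have hone : ∀ y, ¬ CanDecide Q (A.applyOp C p B (.swap x)) y → False := by
    intro y hy
    obtain ⟨E, hE, r, hr, hrE⟩ := hbiv y
    have key : ∀ D, A.Exec Q C D → ¬ CanDecide Q (A.applyOp D p B (.swap x)) y := by
      intro D hD
      induction hD with
      | refl => exact hy
      | @tail D D' hD hs ih =>
        intro hD'
        refine hcon D' (hD.tail hs) fun z => ?_
        by_cases hzy : z = y
        · rwa [hzy]
        obtain ⟨q, hqQ, B', op, hqB, rfl⟩ := hs
        have hpq : p ≠ q := by rintro rfl; exact hp hqQ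
        by_cases hBB : B = B'
        -- The swap of `p` overwrites what `q` did to `B`, so the other process `q'` of the pair
        -- cannot tell whether `q` took its step. It therefore decides the same value alone in both
        -- cases.
        · subst hBB
          obtain ⟨q', hq'Q, hqq⟩ : ∃ q' ∈ Q, q' ≠ q := by
            rcases hqQ with rfl | rfl
            · exact ⟨q₁, by simp [hQ], hq.symm⟩
            · exact ⟨q₀, by simp [hQ], hq⟩
          have hpq' : q' ≠ p := by rintro rfl; exact hp hq'Q
          obtain ⟨t, ht⟩ := exists_canDecide hA (hreach D hD) q'
          have hsub : ({q'} : Set (Fin n)) ⊆ Q := by simpa using hq'Q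
          obtain rfl : t = z := by
            have : t ≠ y := by rintro rfl; exact ih (ht.mono hsub)
            revert this hzy
            clear * -
            revert t z y
            decide
          refine (ht.congr ⟨fun r hr => ?_, ?_⟩).mono hsub
          · obtain rfl : r = q' := hr
            rw [applyOp_state_of_ne _ hpq', applyOp_state_of_ne _ hpq', applyOp_state_of_ne _ hqq]
          · exact applyOp_value_congr (fun B' hB' => (applyOp_value_of_ne _ _ hB' _).symm) rfl
        · rw [← applyOp_comm _ hpq hBB] at hD'
          refine absurd (CanDecide.of_exec (Exec.of_poised hqQ ?_) hD') ih
          rwa [applyOp_state_of_ne _ hpq.symm]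
    refine key E hE ⟨_, Exec.refl _ _, r, hr, ?_⟩
    rw [Decided, applyOp_state_of_ne _ (by rintro rfl; exact hp hr)]
    exact hrE
  exact hcon C (Exec.refl _ _) fun y => by_contra (hone y)

end Valency

/-! ### Events and saturated sets of processes -/

section Events

variable {n b : ℕ} {Obj : Type u} {A : SwapAlgorithm.{u, v} n b Obj}

/-- The next step of `p` in `C` is to swap the value `e.2` into the object `e.1`. -/
def Covers (C : A.Config) (p : Fin n) (e : Obj × Fin b) : Prop :=
  A.status p (C.state p) = .poised e.1 (.swap e.2)

/-- Some execution by processes in `Q` and in `X` leads from `C` to `D`, which is bivalent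
for `Q`. -/
def Visits (Q : Set (Fin n)) (X : Finset (Fin n)) (C D : A.Config) : Prop :=
  A.Exec (Q ∪ X) C D ∧ Bivalent Q D

/-- The event `(e, 0)` says that the object `e.1` has the value `e.2`, and the events `(e, 1)` and
`(e, 2)` say that one, respectively two, of the processes in `X` are about to swap `e.2` into
`e.1`. -/
def Occurs (X : Finset (Fin n)) (C : A.Config) : (Obj × Fin b) × Fin 3 → Prop
  | (e, 0) => C.value e.1 = e.2
  | (e, 1) => ∃ p ∈ X, Covers C p e
  | (e, 2) => ∃ p ∈ X, ∃ q ∈ X, p ≠ q ∧ Covers C p e ∧ Covers C q e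

theorem Covers.congr {C D : A.Config} {p : Fin n} {e : Obj × Fin b} (h : Covers C p e)
    (hp : D.state p = C.state p) : Covers D p e := by
  rwa [Covers, hp]

theorem Visits.trans {Q : Set (Fin n)} {X : Finset (Fin n)} {C D E : A.Config}
    (h : Visits Q X C D) (h' : Visits Q X D E) : Visits Q X C E :=
  ⟨h.1.trans h'.1, h'.2⟩

theorem Visits.mono {Q : Set (Fin n)} {X Y : Finset (Fin n)} (hXY : X ⊆ Y) {C D : A.Config}
    (h : Visits Q X C D) : Visits Q Y C D :=
  ⟨h.1.mono (Set.union_subset_union_right Q (Finset.coe_subset.2 hXY)), h.2⟩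

theorem Occurs.mono {X Y : Finset (Fin n)} (hXY : X ⊆ Y) {C : A.Config} :
    ∀ {e : (Obj × Fin b) × Fin 3}, Occurs X C e → Occurs Y C e
  | (_, 0), h => h
  | (_, 1), ⟨p, hp, h⟩ => ⟨p, hXY hp, h⟩
  | (_, 2), ⟨p, hp, q, hq, h⟩ => ⟨p, hXY hp, q, hXY hq, h⟩

variable [Fintype Obj]

open Classical in
/-- The events that occur in bivalent configurations that processes in `Q` and in `X` reach
from `C`. -/
noncomputable def events (Q : Set (Fin n)) (X : Finset (Fin n)) (C : A.Config) :
    Finset ((Obj × Fin b) × Fin 3) :=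
  Finset.univ.filter fun e => ∃ D, Visits Q X C D ∧ Occurs X D e

theorem mem_events {Q : Set (Fin n)} {X : Finset (Fin n)} {C : A.Config}
    {e : (Obj × Fin b) × Fin 3} : e ∈ events Q X C ↔ ∃ D, Visits Q X C D ∧ Occurs X D e := by
  simp [events]

theorem events_anti {Q : Set (Fin n)} {X : Finset (Fin n)} {C D : A.Config}
    (h : Visits Q X C D) : events Q X D ⊆ events Q X C := by
  intro e he
  obtain ⟨E, hE, hoc⟩ := mem_events.1 he
  exact mem_events.2 ⟨E, h.trans hE, hoc⟩

theorem events_mono {Q : Set (Fin n)} {X Y : Finset (Fin n)} (hXY : X ⊆ Y) (C : A.Config) :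
    events Q X C ⊆ events Q Y C := by
  intro e he
  obtain ⟨E, hE, hoc⟩ := mem_events.1 he
  exact mem_events.2 ⟨E, hE.mono hXY, hoc.mono hXY⟩

theorem card_events_le (Q : Set (Fin n)) (X : Finset (Fin n)) (C : A.Config) :
    (events Q X C).card ≤ 3 * b * Fintype.card Obj := by
  refine (Finset.card_le_univ _).trans (le_of_eq ?_)
  simp only [Fintype.card_prod, Fintype.card_fin]
  ring

/-- In all bivalent configurations that the processes in `Q` and in `X` reach from `C`, every
process in `X` is redundant: the events that occurred so far still occur without its steps. -/
structure Saturated (inp : Fin n → Fin 2) (Q : Set (Fin n)) (X : Finset (Fin n))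
    (C : A.Config) : Prop where
  reachable : A.ReachableWith inp C
  bivalent : Bivalent Q C
  notMem : ∀ p ∈ X, p ∉ Q
  events_erase : ∀ D, Visits Q X C D → ∀ p ∈ X, events Q (X.erase p) D = events Q X C

/-- An unsaturated set has a process whose removal, after a suitable execution, strictly shrinks the
set of events. Starting with one process more than `m` plus the number of events, this must stop
while more than `m` remain. -/
theorem exists_saturated {inp : Fin n → Fin 2} {Q : Set (Fin n)} {T : Finset (Fin n)}
    (hT : ∀ p ∈ T, p ∉ Q) {C : A.Config} (hC : A.ReachableWith inp C) (hbiv : Bivalent Q C)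
    {m : ℕ} (hm : m + 3 * b * Fintype.card Obj < T.card) :
    ∃ (X : Finset (Fin n)) (D : A.Config), m < X.card ∧ Saturated inp Q X D := by
  by_contra! hcon
  have key : ∀ i, ∀ X ⊆ T, X.card = m + i → ∀ D : A.Config, A.ReachableWith inp D →
      Bivalent Q D → i ≤ (events Q X D).card := by
    intro i
    induction i with
    | zero => intros; exact Nat.zero_le _
    | succ i ih =>
      intro X hX hcard D hD hDbiv
      by_contra! hlt
      refine hcon X D (by omega) ⟨hD, hDbiv, fun p hp => hT p (hX hp), fun E hE p hp => ?_⟩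
      refine Finset.eq_of_subset_of_card_le
        ((events_mono (X.erase_subset p) E).trans (events_anti hE))
        ((Nat.lt_succ_iff.1 hlt).trans (ih _ ((X.erase_subset p).trans hX) ?_ E
          (hD.exec hE.1) hE.2))
      rw [Finset.card_erase_of_mem hp, hcard]
      rfl
  obtain ⟨X, hX, hcard⟩ := Finset.exists_subset_card_eq (Nat.succ_le_of_lt hm)
  have := key (3 * b * Fintype.card Obj + 1) X hX (by omega) C hC hbiv
  have := card_events_le Q X C
  omega

/-! ### Simulating solo runs in a saturated configuration -/

namespace Saturated

variable {inp : Fin n → Fin 2} {Q : Set (Fin n)} {X : Finset (Fin n)} {C : A.Config}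

theorem visits_refl (hS : Saturated inp Q X C) : Visits Q X C C :=
  ⟨Exec.refl _ _, hS.bivalent⟩

theorem notMem_union_erase (hS : Saturated inp Q X C) {p : Fin n} (hp : p ∈ X) :
    p ∉ Q ∪ ((X.erase p : Finset (Fin n)) : Set (Fin n)) := by
  simp [hS.notMem p hp]

/-- Every event can occur again, without any step of `p`. -/
theorem exists_occurs (hS : Saturated inp Q X C) {D : A.Config} (hD : Visits Q X C D)
    {p : Fin n} (hp : p ∈ X) {e : (Obj × Fin b) × Fin 3} (he : e ∈ events Q X C) :
    ∃ E, Visits Q X C E ∧ E.state p = D.state p ∧ Occurs (X.erase p) E e := by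
  rw [← hS.events_erase D hD p hp] at he
  obtain ⟨E, hE, hoc⟩ := mem_events.1 he
  exact ⟨E, hD.trans (hE.mono (X.erase_subset p)), hE.1.state_eq (hS.notMem_union_erase hp), hoc⟩

/-- The event that some process covers `e` recurs while `p` stands still, so a second process joins
`p` in covering `e`. -/
theorem mem_events_of_covers (hS : Saturated inp Q X C) {D : A.Config} (hD : Visits Q X C D)
    {p : Fin n} (hp : p ∈ X) {e : Obj × Fin b} (he : Covers D p e) :
    (e, 2) ∈ events Q X C := by
  obtain ⟨E, hE, hst, q, hq, hqe⟩ :=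
    hS.exists_occurs hD hp (mem_events.2 ⟨D, hD, show Occurs X D (e, 1) from ⟨p, hp, he⟩⟩)
  exact mem_events.2 ⟨E, hE, p, hp, q, Finset.mem_of_mem_erase hq,
    (Finset.ne_of_mem_erase hq).symm, he.congr hst, hqe⟩

/-- Without any step of `p`, an object can take a value that another process is about to swap
into it. -/
theorem exists_value_covers {q₀ q₁ : Fin n} (hq : q₀ ≠ q₁) (hA : A.SoloTerminating)
    (hS : Saturated inp {q₀, q₁} X C) {D : A.Config} (hD : Visits {q₀, q₁} X C D)
    {p : Fin n} (hp : p ∈ X) {e : Obj × Fin b} (he : (e, 2) ∈ events {q₀, q₁} X C) :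
    ∃ E, Visits {q₀, q₁} X C E ∧ E.state p = D.state p ∧ E.value e.1 = e.2 ∧
      ∃ k ∈ X, k ≠ p ∧ Covers E k e := by
  obtain ⟨E, hE, hst, k, hk, l, hl, hkl, hke, hle⟩ := hS.exists_occurs hD hp he
  rw [Finset.mem_erase] at hk hl
  -- Of the two covering processes, `l` is spent to install the value and `k` is kept poised.
  obtain ⟨F, hF, hbiv⟩ := hE.2.exists_applyOp hA hq (hS.reachable.exec hE.1) (hS.notMem l hl.2) hle
  have hQ : ∀ r ∈ X, F.state r = E.state r := fun r hr => hF.state_eq (hS.notMem r hr)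
  refine ⟨A.applyOp F l e.1 (.swap e.2), ⟨(hE.1.trans (hF.mono Set.subset_union_left)).trans
    (Exec.of_poised (Or.inr hl.2) (hle.congr (hQ l hl.2))), hbiv⟩, ?_,
    applyOp_value_self _ _ _ _, k, hk.2, hk.1, hke.congr ?_⟩
  · rw [applyOp_state_of_ne _ hl.1.symm, hQ p hp, hst]
  · rw [applyOp_state_of_ne _ hkl, hQ k hk.2]

theorem mem_events_zero {q₀ q₁ : Fin n} (hq : q₀ ≠ q₁) (hA : A.SoloTerminating)
    (hS : Saturated inp {q₀, q₁} X C) {p : Fin n} (hp : p ∈ X) {e : Obj × Fin b}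
    (he : (e, 2) ∈ events {q₀, q₁} X C) : (e, 0) ∈ events {q₀, q₁} X C :=
  let ⟨E, hE, _, hval, _⟩ := hS.exists_value_covers hq hA hS.visits_refl hp he
  mem_events.2 ⟨E, hE, hval⟩

open Classical in
/-- The objects whose value in `E` is one that two processes in `X` can simultaneously be about to
swap into them. -/
noncomputable def coverable (Q : Set (Fin n)) (X : Finset (Fin n)) (C E : A.Config) :
    Finset Obj :=
  Finset.univ.filter fun B => ((B, E.value B), 2) ∈ events Q X C

theorem mem_coverable {E : A.Config} {B : Obj} :
    B ∈ coverable Q X C E ↔ ((B, E.value B), 2) ∈ events Q X C := by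
  simp [coverable]

/-- A step of `p` in `F` that leaves as many objects coverable is simulated by a step of `p`
in a bivalent configuration. -/
theorem exists_visits_step {q₀ q₁ : Fin n} (hq : q₀ ≠ q₁) (hA : A.SoloTerminating)
    (hS : Saturated inp {q₀, q₁} X C) {p : Fin n} (hp : p ∈ X) {D F : A.Config}
    (hD : Visits {q₀, q₁} X C D) (hst : D.state p = F.state p) {B : Obj} {op : SwapOp b}
    (hop : A.status p (F.state p) = .poised B op)
    (hval : ((B, F.value B), 0) ∈ events {q₀, q₁} X C)
    (hcov : op = .read ∨ B ∈ coverable {q₀, q₁} X C F) :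
    ∃ D', Visits {q₀, q₁} X C D' ∧ D'.state p = (A.applyOp F p B op).state p := by
  have hpQ : ∀ r ∈ ({q₀, q₁} : Set (Fin n)), r ≠ p := by
    rintro r hr rfl
    exact hS.notMem r hp hr
  rcases hcov with rfl | hcov
  · obtain ⟨E, hE, hst', hEval : E.value B = F.value B⟩ := hS.exists_occurs hD hp hval
    refine ⟨A.applyOp E p B .read, ⟨hE.1.trans (Exec.of_poised (Or.inr hp) ?_),
      hE.2.congr ⟨fun r hr => ?_, (applyOp_read_value _ _ _).symm⟩⟩, ?_⟩
    · rwa [hst', hst]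
    · rw [applyOp_state_of_ne _ (hpQ r hr)]
    · rw [applyOp_state_self, applyOp_state_self, hEval, hst', hst]
  · obtain ⟨E, hE, hst', hEval, k, hk, hkp, hkE⟩ :=
      hS.exists_value_covers hq hA hD hp (mem_coverable.1 hcov)
    have hkE' : Covers (A.applyOp E p B op) k (B, F.value B) :=
      hkE.congr (applyOp_state_of_ne _ hkp _ _)
    -- Right after `p`'s step, `k` swaps the old value back into `B`. The pair sees no difference
    -- from `E`, so bivalence is preserved.
    refine ⟨A.applyOp (A.applyOp E p B op) k B (.swap (F.value B)),
      ⟨(hE.1.trans (Exec.of_poised (Or.inr hp) ?_)).trans (Exec.of_poised (Or.inr hk) hkE'),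
        hE.2.congr ⟨fun r hr => ?_, ?_⟩⟩, ?_⟩
    · rwa [hst', hst]
    · rw [applyOp_state_of_ne _ (by rintro rfl; exact hS.notMem r hk hr),
        applyOp_state_of_ne _ (hpQ r hr)]
    · funext B'
      by_cases hB : B' = B
      · subst hB
        rw [applyOp_value_self]
        exact hEval
      · rw [applyOp_value_of_ne _ _ hB, applyOp_value_of_ne _ _ hB]
    · rw [applyOp_state_of_ne _ hkp.symm, applyOp_state_self, applyOp_state_self, hst', hst]
      exact congrArg _ hEval

/-- A solo execution of a process that is still in the state that it has in `C` makes another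
object coverable, as the process could not decide otherwise. -/
theorem exists_coverable_ssubset {q₀ q₁ : Fin n} (hq : q₀ ≠ q₁)
    (hA : A.IsObstructionFreeBinaryConsensus) (hS : Saturated inp {q₀, q₁} X C) {p : Fin n}
    (hp : p ∈ X) {E : A.Config} (hE : A.ReachableWith inp E) (hst : E.state p = C.state p)
    (hval : ∀ B, ((B, E.value B), 0) ∈ events {q₀, q₁} X C) :
    ∃ F, A.Exec {p} E F ∧ (∀ B, ((B, F.value B), 0) ∈ events {q₀, q₁} X C) ∧
      coverable {q₀, q₁} X C E ⊂ coverable {q₀, q₁} X C F := by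
  by_contra! hcon
  -- The solo run need not pass through bivalent configurations; the invariant is that `p`'s state
  -- also occurs in some bivalent `D`.
  have key : ∀ F, A.Exec {p} E F → (∀ B, ((B, F.value B), 0) ∈ events {q₀, q₁} X C) ∧
      coverable {q₀, q₁} X C E ⊆ coverable {q₀, q₁} X C F ∧
      ∃ D, Visits {q₀, q₁} X C D ∧ D.state p = F.state p := by
    intro F hF
    induction hF with
    | refl => exact ⟨hval, subset_rfl, C, hS.visits_refl, hst.symm⟩
    | @tail F F' hF hs ih =>
      obtain ⟨hFval, hsub, D, hD, hDF⟩ := ih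
      have hF' : A.Exec {p} E F' := hF.tail hs
      obtain ⟨r, rfl, B, op, hop, rfl⟩ := hs
      cases op with
      | read =>
        refine ⟨by rwa [applyOp_read_value], ?_,
          hS.exists_visits_step hq hA.soloTerminating hp hD hDF hop (hFval B) (Or.inl rfl)⟩
        refine hsub.trans fun B' hB' => ?_
        rw [mem_coverable, applyOp_read_value]
        exact mem_coverable.1 hB'
      | swap x =>
        have hx : ((B, x), 2) ∈ events {q₀, q₁} X C :=
          hS.mem_events_of_covers hD hp (by rw [Covers, hDF]; exact hop)
        have hF'val : ∀ B', (((B', (A.applyOp F r B (.swap x)).value B'), 0) ∈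
            events {q₀, q₁} X C) := by
          intro B'
          by_cases hB : B' = B
          · subst hB
            rw [applyOp_value_self]
            exact hS.mem_events_zero hq hA.soloTerminating hp hx
          · rw [applyOp_value_of_ne _ _ hB]
            exact hFval B'
        have hBmem : B ∈ coverable {q₀, q₁} X C (A.applyOp F r B (.swap x)) := by
          rw [mem_coverable, applyOp_value_self]
          exact hx
        have hsub' : coverable {q₀, q₁} X C F ⊆
            coverable {q₀, q₁} X C (A.applyOp F r B (.swap x)) := by
          intro B' hB'
          by_cases hB : B' = B
          · rwa [hB]
          · rw [mem_coverable, applyOp_value_of_ne _ _ hB]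
            exact mem_coverable.1 hB'
        refine ⟨hF'val, hsub.trans hsub', ?_⟩
        refine hS.exists_visits_step hq hA.soloTerminating hp hD hDF hop (hFval B) (Or.inr ?_)
        -- The swapped value is coverable, so `B` would be newly coverable after the step, which
        -- `hcon` excludes.
        by_contra hB
        exact hcon _ hF' hF'val (Finset.ssubset_iff_of_subset (hsub.trans hsub') |>.2
          ⟨B, hBmem, fun h => hB (hsub h)⟩)
  obtain ⟨F, x, hF, hx⟩ := hA.soloTerminating inp E hE p
  obtain ⟨-, -, D, hD, hDF⟩ := key F hF
  obtain ⟨B, op, hop⟩ := hD.2.exists_poised hA.agreement (hS.reachable.exec hD.1) p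
  rw [hDF, hx] at hop
  cases hop

/-- Solo runs leave the states of the other processes untouched, so each process of `X` in turn
starts from its state in `C` and adds a coverable object. -/
theorem card_le {q₀ q₁ : Fin n} (hq : q₀ ≠ q₁) (hA : A.IsObstructionFreeBinaryConsensus)
    (hS : Saturated inp {q₀, q₁} X C) : X.card ≤ Fintype.card Obj := by
  have key : ∀ Y ⊆ X, ∃ E, A.ReachableWith inp E ∧ (∀ p ∈ X, p ∉ Y → E.state p = C.state p) ∧
      (∀ B, ((B, E.value B), 0) ∈ events {q₀, q₁} X C) ∧
      Y.card ≤ (coverable {q₀, q₁} X C E).card := by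
    intro Y
    induction Y using Finset.induction_on with
    | empty =>
      exact fun _ => ⟨C, hS.reachable, fun _ _ _ => rfl,
        fun B => mem_events.2 ⟨C, hS.visits_refl, rfl⟩, Nat.zero_le _⟩
    | insert p Y hpY ih =>
      intro hY
      obtain ⟨hp, hY⟩ := Finset.insert_subset_iff.1 hY
      obtain ⟨E, hE, hst, hval, hcard⟩ := ih hY
      obtain ⟨F, hF, hFval, hss⟩ := hS.exists_coverable_ssubset hq hA hp hE (hst p hp hpY) hval
      refine ⟨F, hE.exec hF, fun r hr hrY => ?_, hFval, ?_⟩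
      · rw [Finset.mem_insert, not_or] at hrY
        rw [hF.state_eq (by simpa using hrY.1), hst r hr hrY.2]
      · rw [Finset.card_insert_of_notMem hpY]
        exact hcard.trans_lt (Finset.card_lt_card hss)
  obtain ⟨E, -, -, -, h⟩ := key X subset_rfl
  exact h.trans (Finset.card_le_univ _)

end Saturated

/-- At most `card Obj * (3 * b + 1)` processes besides two can take part in an obstruction-free
binary consensus algorithm. -/
theorem IsObstructionFreeBinaryConsensus.le_card (hn : 2 ≤ n)
    (hA : A.IsObstructionFreeBinaryConsensus) : n ≤ Fintype.card Obj * (3 * b + 1) + 2 := by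
  by_contra! hlt
  let q₀ : Fin n := ⟨0, by omega⟩
  let q₁ : Fin n := ⟨1, by omega⟩
  have hq : q₀ ≠ q₁ := by simp [q₀, q₁]
  let inp : Fin n → Fin 2 := fun p => if p = q₀ then 0 else 1
  have h₀ : CanDecide {q₀, q₁} (A.initConfig inp) 0 := by
    simpa [inp] using (canDecide_initConfig hA inp q₀).mono (P' := {q₀, q₁}) (by simp)
  have h₁ : CanDecide {q₀, q₁} (A.initConfig inp) 1 := by
    simpa [inp, hq.symm] using (canDecide_initConfig hA inp q₁).mono (P' := {q₀, q₁}) (by simp)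
  obtain ⟨X, C, hX, hS⟩ := exists_saturated (Q := {q₀, q₁})
    (T := Finset.univ \ {q₀, q₁}) (m := Fintype.card Obj) (by simp)
    (Exec.refl _ _ : A.ReachableWith inp _) (Fin.forall_fin_two.2 ⟨h₀, h₁⟩) (by
      rw [Finset.card_sdiff_of_subset (Finset.subset_univ _), Finset.card_pair hq, Finset.card_univ,
        Fintype.card_fin]
      have : Fintype.card Obj * (3 * b + 1) = Fintype.card Obj + 3 * b * Fintype.card Obj := by
        ring
      omega)
  exact absurd (hS.card_le hq hA) (not_le.2 hX)

end Events

end SwapAlgorithm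

theorem mainTheorem4 {n b : ℕ} (hn : 2 ≤ n) (hb : 2 ≤ b) {Obj : Type u} [Fintype Obj]
    (A : SwapAlgorithm.{u, v} n b Obj) (hA : A.IsObstructionFreeBinaryConsensus) :
    ((n : ℝ) - 2) / (3 * (b : ℝ) + 1) ≤ (Fintype.card Obj : ℝ) := by
  rw [div_le_iff₀ (by positivity), sub_le_iff_le_add]
  exact_mod_cast hA.le_card hn
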